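/- Let $p$ be a prime, let $\mathbb F$ be an algebraic closure of $\mathbb F_p$, and let $$K=\bigcup_{N\ge1}\mathbb F((t^{1/N}))\ \subset\ H=\mathbb F((t^{\mathbb Q}))$$ be the field of Newton–Puiseux series and the Hahn field of generalized power series with well-ordered support, with valuation $v(x)=\min(\operatorname{supp}(x))$, $v(0)=\infty$. Let $\overline K$ be the algebraic closure of $K$ in $H$, and for $b\in\overline K$ let $\deg_K b$ be the degree of the minimal polynomial of $b$ over $K$. For $m,n\ge 0$ put $$s_m=\sum_{j\ge m}\binom jm t^{-1/p^{j+1}}\in H,\qquad s_{n,n}=\sum_{m=0}^{n-1}t^m s_m\in H .$$ For $a\in\overline K$ and $\delta\in\mathbb Q$ let $B_\delta(a)=\{b\in\overline K\mid v(b-a)\ge\delta\}$ and $\deg_K B_\delta(a)=\min\{\deg_K b\mid b\in B_\delta(a)\}$. Then for every $n\ge1$ one has $s_{n,n}\in\overline K$, every element of $B_{n-1}(s_{n,n})$ has degree at least $p^n$ over $K$, and $$\deg_K B_{n-1}(s_{n,n})=p^n .$$ -/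

import Mathlib

noncomputable section

namespace HahnTower

/-- The Hahn field `H = F((t^ℚ))` of generalized power series with well-ordered support. -/
abbrev Hahn (F : Type*) [Field F] : Type _ := HahnSeries ℚ F

/-- The map `ℤ → ℚ`, `k ↦ k / N`. -/
def divHom (N : ℕ+) : ℤ →+ ℚ where
  toFun k := (k : ℚ) / ((N : ℕ) : ℚ)
  map_zero' := by simp
  map_add' a b := by push_cast; ring

theorem divHom_apply (N : ℕ+) (k : ℤ) : divHom N k = (k : ℚ) / ((N : ℕ) : ℚ) := rfl

theorem divHom_le (N : ℕ+) (a b : ℤ) : divHom N a ≤ divHom N b ↔ a ≤ b := by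
  have hN : (0 : ℚ) < ((N : ℕ) : ℚ) := by exact_mod_cast N.pos
  rw [divHom_apply, divHom_apply, div_le_div_iff_of_pos_right hN]
  exact_mod_cast Iff.rfl

theorem divHom_injective (N : ℕ+) : Function.Injective (divHom N) := fun a b h =>
  le_antisymm ((divHom_le N a b).1 h.le) ((divHom_le N b a).1 h.ge)

/-- The embedding `F((t)) → H`, `t ↦ t^{1/N}`. -/
def laurentEmb (F : Type*) [Field F] (N : ℕ+) : LaurentSeries F →+* Hahn F :=
  HahnSeries.embDomainRingHom (divHom N) (divHom_injective N) (divHom_le N)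

/-- The subfield `F((t^{1/N}))` of `H`. -/
def laurentRoot (F : Type*) [Field F] (N : ℕ+) : Subfield (Hahn F) :=
  (laurentEmb F N).fieldRange

theorem mem_laurentRoot {F : Type*} [Field F] {N : ℕ+} {x : Hahn F} :
    x ∈ laurentRoot F N ↔ ∀ q ∈ x.support, ∃ k : ℤ, q = (k : ℚ) / ((N : ℕ) : ℚ) := by
  constructor
  · rintro ⟨y, rfl⟩ q hq
    obtain ⟨k, -, rfl⟩ := HahnSeries.support_embDomain_subset hq
    exact ⟨k, rfl⟩
  · intro h
    let f : ℤ ↪o ℚ := ⟨⟨divHom N, divHom_injective N⟩, divHom_le N _ _⟩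
    have hpwo : (Function.support fun k : ℤ => x.coeff (divHom N k)).IsPWO := by
      have hx : x.support.IsWF := x.isPWO_support.isWF
      refine Set.IsWF.isPWO ?_
      rw [Set.isWF_iff_no_descending_seq]
      intro u hu hmem
      exact Set.isWF_iff_no_descending_seq.1 hx (fun n => f (u n))
        (fun a b hab => f.strictMono (hu hab)) hmem
    refine ⟨⟨fun k => x.coeff (divHom N k), hpwo⟩, ?_⟩
    ext q
    by_cases hq : ∃ k : ℤ, q = divHom N k
    · obtain ⟨k, rfl⟩ := hq
      exact HahnSeries.embDomain_coeff (f := f)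
    · have h0 : x.coeff q = 0 := by
        by_contra hne
        exact hq (h q hne)
      rw [h0]
      refine HahnSeries.embDomain_of_notMem_range (f := f) ?_
      rintro ⟨k, hk⟩
      exact hq ⟨k, hk.symm⟩

theorem laurentRoot_le_mul {F : Type*} [Field F] (N M : ℕ+) :
    laurentRoot F N ≤ laurentRoot F (N * M) := by
  intro x hx
  rw [mem_laurentRoot] at hx ⊢
  intro q hq
  obtain ⟨k, rfl⟩ := hx q hq
  refine ⟨k * (M : ℕ), ?_⟩
  have hN : ((N : ℕ) : ℚ) ≠ 0 := by exact_mod_cast N.ne_zero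
  have hM : ((M : ℕ) : ℚ) ≠ 0 := by exact_mod_cast M.ne_zero
  push_cast
  field_simp

theorem exists_common {F : Type*} [Field F] {x y : Hahn F}
    (hx : ∃ N, x ∈ laurentRoot F N) (hy : ∃ N, y ∈ laurentRoot F N) :
    ∃ N, x ∈ laurentRoot F N ∧ y ∈ laurentRoot F N := by
  obtain ⟨N, hN⟩ := hx
  obtain ⟨M, hM⟩ := hy
  exact ⟨N * M, laurentRoot_le_mul N M hN, by rw [mul_comm]; exact laurentRoot_le_mul M N hM⟩

/-- The Newton-Puiseux field `K = ⋃_{N ≥ 1} F((t^{1/N}))`, as a subfield of `H`. -/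
def Puiseux (F : Type*) [Field F] : Subfield (Hahn F) where
  carrier := {x | ∃ N : ℕ+, x ∈ laurentRoot F N}
  zero_mem' := ⟨1, zero_mem _⟩
  one_mem' := ⟨1, one_mem _⟩
  add_mem' hx hy := (exists_common hx hy).imp fun _ h => add_mem h.1 h.2
  mul_mem' hx hy := (exists_common hx hy).imp fun _ h => mul_mem h.1 h.2
  neg_mem' hx := hx.imp fun _ h => neg_mem h
  inv_mem' _ hx := hx.imp fun _ h => inv_mem h

/-- The algebraic closure of `K` inside `H`. -/
def Kbar (F : Type*) [Field F] : IntermediateField (Puiseux F) (Hahn F) :=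
  algebraicClosure (Puiseux F) (Hahn F)

/-- The valuation `v(x) = min (supp x)` on `H`, with `v(0) = ∞`. -/
def v {F : Type*} [Field F] (x : Hahn F) : WithTop ℚ := x.orderTop

/-- The degree of `b` over `K`, that is, the degree of its minimal polynomial. -/
def deg {F : Type*} [Field F] (b : Hahn F) : ℕ := (minpoly (Puiseux F) b).natDegree

/-- The ball `B_δ(a) = {b ∈ Kbar | v (b - a) ≥ δ}`. -/
def ball {F : Type*} [Field F] (δ : ℚ) (a : Hahn F) : Set (Hahn F) :=
  {b | b ∈ Kbar F ∧ (δ : WithTop ℚ) ≤ v (b - a)}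

/-- The degree over `K` of a set `B`: the minimal degree of its elements. -/
def degSet {F : Type*} [Field F] (B : Set (Hahn F)) : ℕ := sInf (deg '' B)

/-- The strictly increasing sequence of exponents `j ↦ -1 / p ^ (j + 1)`. -/
def expo (p : ℕ) [hp : Fact p.Prime] : ℕ ↪o ℚ :=
  OrderEmbedding.ofStrictMono (fun j => -1 / (p : ℚ) ^ (j + 1)) <| by
    intro a b hab
    have h1 : (1 : ℚ) < p := by exact_mod_cast hp.out.one_lt
    have h0 : (0 : ℚ) < (p : ℚ) ^ (a + 1) := by positivity
    have h2 : (p : ℚ) ^ (a + 1) < (p : ℚ) ^ (b + 1) := pow_lt_pow_right₀ h1 (by omega)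
    have h3 := one_div_lt_one_div_of_lt h0 h2
    simp only [neg_div]
    linarith

/-- The series `s_n = ∑_{j ≥ n} (j choose n) t ^ (-1 / p ^ (j + 1))` of `H`
(the binomial coefficient vanishes for `j < n`). -/
def s (p : ℕ) [Fact p.Prime] (F : Type*) [Field F] (n : ℕ) : Hahn F :=
  HahnSeries.embDomain (expo p) ⟨fun j => (j.choose n : F), Set.IsWF.isPWO (Set.IsWF.of_wellFoundedLT _)⟩

theorem s_coeff (p : ℕ) [Fact p.Prime] (F : Type*) [Field F] (n j : ℕ) :
    (s p F n).coeff (-1 / (p : ℚ) ^ (j + 1)) = (j.choose n : F) :=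
  HahnSeries.embDomain_coeff (f := expo p)

theorem s_coeff_of_ne (p : ℕ) [Fact p.Prime] (F : Type*) [Field F] (n : ℕ) (q : ℚ)
    (hq : ∀ j : ℕ, q ≠ -1 / (p : ℚ) ^ (j + 1)) : (s p F n).coeff q = 0 :=
  HahnSeries.embDomain_of_notMem_range (f := expo p) (by rintro ⟨j, rfl⟩; exact hq j rfl)

/-- The indeterminate `t`. -/
def t (F : Type*) [Field F] : Hahn F := HahnSeries.single 1 1

/-- The truncation `s_{n,n} = ∑_{m = 0}^{n - 1} t ^ m s_m`. -/
def sDiag (p : ℕ) [Fact p.Prime] (F : Type*) [Field F] (n : ℕ) : Hahn F :=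
  ∑ m ∈ Finset.range n, t F ^ m * s p F m

end HahnTower

end

/-!
Let `A x = x ^ p - x`. Pascal's rule gives `A s_0 = t⁻¹` and `A s_m = s_{m-1}`, so that
`K(s_0, …, s_{n-1}) = K(s_{n-1})` and `A ^ n s_{n-1} = t⁻¹`.

This field has degree `p ^ n` over `K`. The conjugates of `s_{n-1}` are its translates by a finite
subgroup `V` of `F`. If `V` had fewer than `p ^ n` elements, the additive maps `1, A, …, A ^ (n-1)`
from `V` to `F` would satisfy a linear relation `∑ g_l A ^ l = 0`. Then `∑ g_l A ^ l s_{n-1}`, which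
is a linear combination `∑_m b_m s_m` with `m < n`, would equal all its conjugates and lie in `K`.
Elements of `K` have exponents of bounded denominator, so the coefficients `∑_m b_m (j choose m)` of
this combination would vanish for all large `j`, which forces `b = 0`.

Now let `v(u - s_{n,n}) ≥ n - 1`. Since `v(t^m s_m) ≥ m - 1`, also `v(u - s_{i+1,i+1}) ≥ i` for
`i < n`. Once `K(u)` contains `s_0, …, s_{i-1}`, it contains `y = t^{-i} (u - s_{i,i})`, and
`v(y - s_i) ≥ 0`. As `A s_i` is in `K(u)` as well, Hensel's lemma for `A` puts `s_i` into `K(u)`.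
-/

noncomputable section

namespace HahnTower

section Valuation

variable {F : Type*} [Field F]

theorem lt_v_iff {x : Hahn F} {q : ℚ} : (q : WithTop ℚ) < v x ↔ ∀ r ≤ q, x.coeff r = 0 := by
  refine ⟨fun h r hr =>
    HahnSeries.coeff_eq_zero_of_lt_orderTop ((WithTop.coe_le_coe.2 hr).trans_lt h), fun h => ?_⟩
  exact (HahnSeries.le_orderTop_iff_forall.2 fun r hr => h r (WithTop.coe_lt_coe.1 hr).le).lt_of_ne
    (HahnSeries.orderTop_ne_of_coeff_eq_zero (h q le_rfl)).symm

theorem v_mul (x y : Hahn F) : v (x * y) = v x + v y := HahnSeries.orderTop_mul x y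

theorem zero_lt_v_sub_C {x : Hahn F} (hx : 0 ≤ v x) : 0 < v (x - HahnSeries.C (x.coeff 0)) := by
  refine lt_v_iff.2 fun r hr => ?_
  rw [HahnSeries.coeff_sub, HahnSeries.C_apply]
  rcases hr.lt_or_eq with hr | rfl
  · rw [HahnSeries.le_orderTop_iff_forall.1 hx r (WithTop.coe_lt_coe.2 hr),
      HahnSeries.coeff_single_of_ne hr.ne, sub_zero]
  · rw [HahnSeries.coeff_single_same, sub_self]

theorem v_t_pow (m : ℕ) : v (t F ^ m) = ((m : ℚ) : WithTop ℚ) := by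
  rw [t, HahnSeries.single_pow, one_pow, v, HahnSeries.orderTop_single one_ne_zero, nsmul_one]

end Valuation

section NormedField

/-- The strictly decreasing exponential `q ↦ 2 ^ (-q)` with `⊤ ↦ 0`, which turns the valuation `v`
into a norm. -/
def twoPowNeg : WithTop ℚ → ℝ := WithTop.recTopCoe 0 fun q => 2 ^ (-q : ℝ)

theorem twoPowNeg_coe (q : ℚ) : twoPowNeg q = 2 ^ (-q : ℝ) := rfl

theorem twoPowNeg_top : twoPowNeg ⊤ = 0 := rfl

theorem twoPowNeg_coe_pos (q : ℚ) : 0 < twoPowNeg q := Real.rpow_pos_of_pos two_pos _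

theorem twoPowNeg_nonneg : ∀ q : WithTop ℚ, 0 ≤ twoPowNeg q
  | ⊤ => le_rfl
  | (q : ℚ) => (twoPowNeg_coe_pos q).le

theorem twoPowNeg_strictAnti : StrictAnti twoPowNeg
  | (a : ℚ), ⊤, _ => twoPowNeg_coe_pos a
  | (_ : ℚ), (_ : ℚ), h => Real.rpow_lt_rpow_of_exponent_lt one_lt_two <|
      neg_lt_neg (Rat.cast_lt.2 (WithTop.coe_lt_coe.1 h))

theorem twoPowNeg_add : ∀ a b : WithTop ℚ, twoPowNeg (a + b) = twoPowNeg a * twoPowNeg b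
  | ⊤, b => by rw [top_add, twoPowNeg_top, zero_mul]
  | (a : ℚ), ⊤ => by rw [add_top, twoPowNeg_top, mul_zero]
  | (a : ℚ), (b : ℚ) => by
    rw [← WithTop.coe_add, twoPowNeg_coe, twoPowNeg_coe, twoPowNeg_coe, ← Real.rpow_add two_pos,
      Rat.cast_add, neg_add]

theorem exists_twoPowNeg_lt {ε : ℝ} (hε : 0 < ε) : ∃ q : ℚ, twoPowNeg q < ε := by
  obtain ⟨n, hn⟩ := exists_pow_lt_of_lt_one hε one_half_lt_one
  refine ⟨n, ?_⟩
  rwa [twoPowNeg_coe, Rat.cast_natCast, Real.rpow_neg zero_le_two, Real.rpow_natCast, ← inv_pow,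
    ← one_div]

variable {F : Type*} [Field F]

/-- The absolute value `|x| = 2 ^ (-v x)` on `H`. -/
def hahnAbs (F : Type*) [Field F] : AbsoluteValue (Hahn F) ℝ where
  toFun x := twoPowNeg (v x)
  map_mul' x y := by rw [v_mul, twoPowNeg_add]
  nonneg' x := twoPowNeg_nonneg _
  eq_zero' x := by
    rw [← twoPowNeg_top, twoPowNeg_strictAnti.injective.eq_iff, v, HahnSeries.orderTop_eq_top]
  add_le' x y :=
    calc twoPowNeg (v (x + y)) ≤ twoPowNeg (min (v x) (v y)) :=
          twoPowNeg_strictAnti.antitone HahnSeries.min_orderTop_le_orderTop_add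
      _ = max (twoPowNeg (v x)) (twoPowNeg (v y)) := twoPowNeg_strictAnti.antitone.map_min
      _ ≤ twoPowNeg (v x) + twoPowNeg (v y) :=
          max_le_add_of_nonneg (twoPowNeg_nonneg _) (twoPowNeg_nonneg _)

/-- `H` as a normed field, under the absolute value `hahnAbs`. -/
@[reducible]
def hahnNormedField (F : Type*) [Field F] : NormedField (Hahn F) := (hahnAbs F).toNormedField

attribute [local instance] hahnNormedField

theorem norm_lt_twoPowNeg_iff {x : Hahn F} {q : WithTop ℚ} : ‖x‖ < twoPowNeg q ↔ q < v x :=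
  twoPowNeg_strictAnti.lt_iff_gt

theorem norm_lt_one_iff {x : Hahn F} : ‖x‖ < 1 ↔ 0 < v x := by
  rw [← norm_lt_twoPowNeg_iff, ← WithTop.coe_zero, twoPowNeg_coe, Rat.cast_zero, neg_zero,
    Real.rpow_zero]

/-- Up to any given exponent, the coefficients of a Cauchy sequence are eventually constant. So the
coefficientwise limit agrees there with a term of the sequence, and has well-ordered support. -/
theorem exists_tendsto_of_cauchySeq {a : ℕ → Hahn F} (ha : CauchySeq a) :
    ∃ b, Filter.Tendsto a Filter.atTop (nhds b) := by
  have hN (q : ℚ) : ∃ N, ∀ m ≥ N, ∀ n ≥ N, ∀ r ≤ q, (a m).coeff r = (a n).coeff r := by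
    obtain ⟨N, hN⟩ := Metric.cauchySeq_iff.1 ha _ (twoPowNeg_coe_pos q)
    refine ⟨N, fun m hm n hn r hr => ?_⟩
    have h := hN m hm n hn
    rw [dist_eq_norm, norm_lt_twoPowNeg_iff, lt_v_iff] at h
    exact sub_eq_zero.1 (h r hr)
  choose N hN using hN
  have hcoeff {q r : ℚ} (hr : r ≤ q) : (a (N r)).coeff r = (a (N q)).coeff r :=
    (hN r _ (le_max_left _ _) _ le_rfl r le_rfl).symm.trans
      (hN q _ (le_max_right _ _) _ le_rfl r hr)
  have hpwo : (Function.support fun q => (a (N q)).coeff q).IsPWO := by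
    refine Set.IsWF.isPWO <| Set.isWF_iff_no_descending_seq.2 fun u hu hmem => ?_
    refine Set.isWF_iff_no_descending_seq.1 (a (N (u 0))).isWF_support u hu fun n => ?_
    rw [HahnSeries.mem_support, ← hcoeff (hu.antitone (Nat.zero_le n))]
    exact hmem n
  refine ⟨⟨_, hpwo⟩, Metric.tendsto_atTop.2 fun ε hε => ?_⟩
  obtain ⟨q, hq⟩ := exists_twoPowNeg_lt hε
  refine ⟨N q, fun n hn => (dist_eq_norm (a n) _).trans_lt (lt_trans ?_ hq)⟩
  rw [norm_lt_twoPowNeg_iff, lt_v_iff]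
  intro r hr
  rw [HahnSeries.coeff_sub, sub_eq_zero, hN q n hn _ le_rfl r hr]
  exact (hcoeff hr).symm

theorem completeSpace_hahn : CompleteSpace (Hahn F) :=
  Metric.complete_of_cauchySeq_tendsto fun _ => exists_tendsto_of_cauchySeq

theorem isClosed_laurentRoot (N : ℕ+) : IsClosed (laurentRoot F N : Set (Hahn F)) := by
  refine isClosed_of_closure_subset fun x hx => mem_laurentRoot.2 fun q hq => ?_
  obtain ⟨y, hy, hxy⟩ := Metric.mem_closure_iff.1 hx _ (twoPowNeg_coe_pos q)
  rw [dist_eq_norm, norm_lt_twoPowNeg_iff, lt_v_iff] at hxy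
  rw [HahnSeries.mem_support, sub_eq_zero.1 (hxy q le_rfl)] at hq
  exact mem_laurentRoot.1 hy q hq

theorem t_mem_laurentRoot (N : ℕ+) : t F ∈ laurentRoot F N := by
  refine mem_laurentRoot.2 fun q hq => ⟨N, ?_⟩
  rw [Set.mem_singleton_iff.1 (HahnSeries.support_single_subset hq), Int.cast_natCast,
    div_self (Nat.cast_ne_zero.2 N.ne_zero)]

theorem t_ne_zero : t F ≠ 0 := HahnSeries.single_ne_zero one_ne_zero

/-- The nontrivially normed structure of `F((t^{1/N}))`, as a subfield of `H`. -/
@[reducible]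
def laurentRootNormedField (N : ℕ+) : NontriviallyNormedField (laurentRoot F N) where
  non_trivial := by
    have ht : ‖t F‖ < 1 := by
      rw [norm_lt_one_iff, ← pow_one (t F), v_t_pow]
      exact WithTop.coe_lt_coe.2 (Nat.cast_pos.2 one_pos)
    refine ⟨⟨t F, t_mem_laurentRoot N⟩⁻¹, ?_⟩
    rw [norm_inv]
    exact (one_lt_inv₀ (norm_pos_iff.2 fun h => t_ne_zero (congrArg Subtype.val h))).2 ht

local instance laurentRootNormedAlgebra (N : ℕ+) : NormedAlgebra (laurentRoot F N) (Hahn F) where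
  norm_smul_le r x := (norm_mul (r : Hahn F) x).le

open IntermediateField in
/-- With `z = w ^ p - w`, the partial sums of `-∑ z ^ p ^ i` telescope to `w - w ^ p ^ k`, so they
converge to `w`, and a finite-dimensional extension of `𝕜` is closed. -/
theorem mem_adjoin_pow_sub_self {𝕜 H : Type*} [NontriviallyNormedField 𝕜] [CompleteSpace 𝕜]
    [NormedField H] [NormedAlgebra 𝕜 H] (p : ℕ) [Fact p.Prime] [CharP H p] {w : H} (hw : ‖w‖ < 1)
    (hintegral : IsIntegral 𝕜 (w ^ p - w)) : w ∈ 𝕜⟮w ^ p - w⟯ := by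
  set z := w ^ p - w with hz
  have : FiniteDimensional 𝕜 𝕜⟮z⟯ := adjoin.finiteDimensional hintegral
  have hclosed : IsClosed (𝕜⟮z⟯ : Set H) :=
    Submodule.closed_of_finiteDimensional 𝕜⟮z⟯.toSubalgebra.toSubmodule
  have hsum (k : ℕ) : w - w ^ p ^ k = -∑ i ∈ Finset.range k, z ^ p ^ i := by
    simp only [hz, sub_pow_char_pow, ← pow_mul, ← pow_succ']
    rw [Finset.sum_range_sub (fun i => w ^ p ^ i), pow_zero, pow_one, neg_sub]
  have hlim : Filter.Tendsto (fun k => w - w ^ p ^ k) Filter.atTop (nhds (w - 0)) :=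
    tendsto_const_nhds.sub <| (tendsto_pow_atTop_nhds_zero_of_norm_lt_one hw).comp <|
      tendsto_pow_atTop_atTop_of_one_lt (Fact.out : p.Prime).one_lt
  rw [sub_zero] at hlim
  refine hclosed.mem_of_tendsto hlim (.of_forall fun k => ?_)
  rw [hsum]
  exact neg_mem (sum_mem fun i _ => pow_mem (mem_adjoin_simple_self 𝕜 z) _)

theorem exists_subset_laurentRoot {S : Finset (Hahn F)} (hS : (S : Set (Hahn F)) ⊆ Puiseux F) :
    ∃ N, (S : Set (Hahn F)) ⊆ laurentRoot F N := by
  have hdir : Directed (· ⊆ ·) fun N : ℕ+ => (laurentRoot F N : Set (Hahn F)) := fun N M =>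
    ⟨N * M, laurentRoot_le_mul N M, (laurentRoot_le_mul M N).trans_eq (by rw [mul_comm])⟩
  exact hdir.exists_mem_subset_of_finset_subset_biUnion fun x hx => Set.mem_iUnion.2 (hS hx)

open Polynomial in
theorem exists_isIntegral_laurentRoot {z : Hahn F} (hz : IsIntegral (Puiseux F) z) :
    ∃ N : ℕ+, IsIntegral (laurentRoot F N) z := by
  set P : (Hahn F)[X] := (minpoly (Puiseux F) z).map (algebraMap _ _)
  have hP : (P.coeffs : Set (Hahn F)) ⊆ Puiseux F := fun c hc => by
    obtain ⟨i, -, rfl⟩ := mem_coeffs_iff.1 hc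
    rw [coeff_map]
    exact ((minpoly (Puiseux F) z).coeff i).2
  obtain ⟨N, hN⟩ := exists_subset_laurentRoot hP
  refine ⟨N, P.toSubring (laurentRoot F N).toSubring hN,
    (monic_toSubring _ _ _).2 ((minpoly.monic hz).map _), ?_⟩
  rw [eval₂_eq_eval_map]
  exact (congrArg (eval z) (map_toSubring _ _ _)).trans ((eval_map_algebraMap _ _).trans
    (minpoly.aeval _ _))

open IntermediateField in
/-- `K` is not complete, but `w ^ p - w` is already algebraic over one of the complete fields
`F((t^{1/N}))`. -/
theorem mem_of_pow_sub_self_mem {p : ℕ} [Fact p.Prime] [CharP (Hahn F) p]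
    {E : IntermediateField (Puiseux F) (Hahn F)} (hE : E ≤ Kbar F) {w : Hahn F} (hw : 0 < v w)
    (hz : w ^ p - w ∈ E) : w ∈ E := by
  obtain ⟨N, hN⟩ := exists_isIntegral_laurentRoot (hE hz)
  let := laurentRootNormedField (F := F) N
  have : CompleteSpace (Hahn F) := completeSpace_hahn
  have : CompleteSpace (laurentRoot F N) := (isClosed_laurentRoot N).completeSpace_coe
  have hle : (laurentRoot F N)⟮w ^ p - w⟯.toSubfield ≤ E.toSubfield := by
    rw [adjoin_toSubfield, Subfield.closure_le]
    rintro x (⟨y, rfl⟩ | rfl)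
    · exact E.algebraMap_mem ⟨y, N, y.2⟩
    · exact hz
  exact hle (mem_adjoin_pow_sub_self p (norm_lt_one_iff.2 hw) hN)

theorem C_mem_Puiseux (c : F) : HahnSeries.C c ∈ Puiseux F :=
  ⟨1, mem_laurentRoot.2 fun q hq => ⟨0, by
    simpa using HahnSeries.support_single_subset hq⟩⟩

theorem t_mem_Puiseux : t F ∈ Puiseux F := ⟨1, t_mem_laurentRoot 1⟩

theorem t_mem (E : IntermediateField (Puiseux F) (Hahn F)) : t F ∈ E :=
  E.algebraMap_mem ⟨t F, t_mem_Puiseux⟩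

/-- The constant term of `y - x` lies in `F`, and Hensel's lemma for `X ^ p - X` recovers the rest
of `y - x` from its image. -/
theorem mem_of_zero_le_v_sub {p : ℕ} [Fact p.Prime] [CharP (Hahn F) p]
    {E : IntermediateField (Puiseux F) (Hahn F)} (hE : E ≤ Kbar F) {x y : Hahn F}
    (hx : x ^ p - x ∈ E) (hy : y ∈ E) (h : 0 ≤ v (y - x)) : x ∈ E := by
  set c : Hahn F := HahnSeries.C ((y - x).coeff 0)
  have hc : c ∈ E := E.algebraMap_mem ⟨c, C_mem_Puiseux _⟩
  have hw : y - x - c ∈ E := by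
    refine mem_of_pow_sub_self_mem (p := p) hE ?_ ?_
    · exact zero_lt_v_sub_C h
    · have : (y - x - c) ^ p - (y - x - c) = (y ^ p - y) - (x ^ p - x) - (c ^ p - c) := by
        rw [sub_pow_char, sub_pow_char]
        ring
      rw [this]
      exact sub_mem (sub_mem (sub_mem (pow_mem hy p) hy) hx) (sub_mem (pow_mem hc p) hc)
  have : x = y - (y - x - c) - c := by ring
  rw [this]
  exact sub_mem (sub_mem hy hw) hc

end NormedField

section Frobenius

open Set Pointwise

variable {Γ R : Type*} [AddCommMonoid Γ] [LinearOrder Γ] [IsOrderedCancelAddMonoid Γ]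

theorem support_pow_subset [Semiring R] {A : ℕ → Set Γ} (hA : ∀ k, A k + A 1 ⊆ A (k + 1))
    {x : HahnSeries Γ R} (hx : x.support ⊆ A 1) {k : ℕ} (hk : k ≠ 0) : (x ^ k).support ⊆ A k := by
  induction k, Nat.one_le_iff_ne_zero.2 hk using Nat.le_induction with
  | base => rwa [pow_one]
  | succ k h ih =>
    rw [pow_succ]
    exact HahnSeries.support_mul_subset.trans ((add_subset_add (ih (by lia)) hx).trans (hA k))

/-- Frobenius is additive, and only the term of exponent `q` of `x` contributes to the exponent
`p • q` of `x ^ p`. -/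
theorem coeff_nsmul_pow_char [CommRing R] (p : ℕ) [Fact p.Prime] [CharP (HahnSeries Γ R) p]
    (x : HahnSeries Γ R) (q : Γ) : (x ^ p).coeff (p • q) = x.coeff q ^ p := by
  have hp : p ≠ 0 := (Fact.out : p.Prime).ne_zero
  set y := HahnSeries.truncLT q x with hy
  set c := HahnSeries.single q (x.coeff q) with hc
  have hylt : (y ^ p).support ⊆ Iio (p • q) := by
    refine support_pow_subset (A := fun k => Iio (k • q)) ?_ (fun r hr => ?_) hp
    · rintro k _ ⟨a, ha, b, hb, rfl⟩
      simpa only [mem_Iio, succ_nsmul, zero_nsmul, zero_add] using add_lt_add ha hb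
    · rw [hy, HahnSeries.support_truncLT] at hr
      simpa using hr.2
  have hzgt : ((x - y - c) ^ p).support ⊆ Ioi (p • q) := by
    refine support_pow_subset (A := fun k => Ioi (k • q)) ?_ (fun r hr => ?_) hp
    · rintro k _ ⟨a, ha, b, hb, rfl⟩
      simpa only [mem_Ioi, succ_nsmul, zero_nsmul, zero_add] using add_lt_add ha hb
    · rw [mem_Ioi, one_nsmul]
      by_contra! hle
      refine hr ?_
      rw [HahnSeries.coeff_sub, HahnSeries.coeff_sub]
      rcases hle.lt_or_eq with h | rfl
      · rw [HahnSeries.coeff_truncLT_of_lt h, HahnSeries.coeff_single_of_ne h.ne, sub_self,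
          sub_zero]
      · rw [HahnSeries.coeff_truncLT_of_le le_rfl, HahnSeries.coeff_single_same, sub_zero, sub_self]
  have hx : x ^ p = y ^ p + c ^ p + (x - y - c) ^ p := by
    rw [← add_pow_char, ← add_pow_char]
    congr 1
    ring
  rw [hx, HahnSeries.coeff_add, HahnSeries.coeff_add, hc, HahnSeries.single_pow,
    HahnSeries.coeff_single_same, Function.notMem_support.1 fun h => lt_irrefl _ (hylt h),
    Function.notMem_support.1 fun h => lt_irrefl _ (hzgt h), zero_add, add_zero]

end Frobenius

section Series

variable (p : ℕ) [Fact p.Prime] (F : Type*) [Field F]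

instance charP_hahn [CharP F p] : CharP (Hahn F) p :=
  charP_of_injective_ringHom HahnSeries.C_injective p

theorem mul_expo_succ (j : ℕ) : p * expo p (j + 1) = expo p j := by
  have : (p : ℚ) ≠ 0 := NeZero.ne _
  change (p : ℚ) * (-1 / p ^ (j + 1 + 1)) = -1 / p ^ (j + 1)
  field_simp
  ring

theorem mul_expo_zero : p * expo p 0 = -1 := by
  have : (p : ℚ) ≠ 0 := NeZero.ne _
  change (p : ℚ) * (-1 / p ^ (0 + 1)) = -1
  field_simp
  ring

theorem neg_one_lt_expo (j : ℕ) : -1 < expo p j := by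
  have hp : (1 : ℚ) < p := Nat.one_lt_cast.2 (Fact.out : p.Prime).one_lt
  have h0 : -1 < expo p 0 := by nlinarith [mul_expo_zero p]
  exact h0.trans_le ((expo p).monotone (Nat.zero_le j))

variable {p} in
theorem ne_expo_of_mul {q : ℚ} (hq : ∀ j, q ≠ expo p j) (j : ℕ) : p * q ≠ expo p j := by
  rw [← mul_expo_succ]
  exact fun h => hq (j + 1) (mul_left_cancel₀ (NeZero.ne _) h)

theorem s_coeff_expo (m j : ℕ) : (s p F m).coeff (expo p j) = (j.choose m : F) := s_coeff p F m j

theorem s_coeff_neg_one (m : ℕ) : (s p F m).coeff (-1) = 0 :=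
  s_coeff_of_ne p F m _ fun j => (neg_one_lt_expo p j).ne

theorem neg_one_le_v_s (m : ℕ) : ((-1 : ℚ) : WithTop ℚ) ≤ v (s p F m) :=
  HahnSeries.le_orderTop_iff_forall.2 fun _ hr => s_coeff_of_ne p F m _ fun j =>
    ((WithTop.coe_lt_coe.1 hr).trans (neg_one_lt_expo p j)).ne

variable [CharP F p]

theorem s_coeff_pow_char (m : ℕ) (q : ℚ) : (s p F m).coeff q ^ p = (s p F m).coeff q := by
  by_cases hq : ∃ j, q = expo p j
  · obtain ⟨j, rfl⟩ := hq
    exact (congrArg (· ^ p) (s_coeff p F m j)).trans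
      ((map_natCast (frobenius F p) _).trans (s_coeff p F m j).symm)
  · rw [s_coeff_of_ne p F m q (not_exists.1 hq), zero_pow (NeZero.ne p)]

theorem coeff_s_pow (m : ℕ) (q : ℚ) : (s p F m ^ p).coeff (p * q) = (s p F m).coeff q := by
  rw [← nsmul_eq_mul, coeff_nsmul_pow_char, s_coeff_pow_char]

theorem s_zero_pow_sub : s p F 0 ^ p - s p F 0 = (t F)⁻¹ := by
  rw [t, HahnSeries.inv_single, inv_one]
  ext r
  obtain ⟨q, rfl⟩ : ∃ q, r = p * q := ⟨r / p, (mul_div_cancel₀ _ (NeZero.ne _)).symm⟩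
  rw [HahnSeries.coeff_sub, coeff_s_pow]
  by_cases hq : ∃ j, q = expo p j
  · obtain ⟨_ | j, rfl⟩ := hq
    · rw [mul_expo_zero, s_coeff_expo, s_coeff_neg_one, HahnSeries.coeff_single_same,
        Nat.choose_zero_right, Nat.cast_one, sub_zero]
    · rw [mul_expo_succ, s_coeff_expo, s_coeff_expo,
        HahnSeries.coeff_single_of_ne (neg_one_lt_expo p j).ne', Nat.choose_zero_right,
        Nat.choose_zero_right, sub_self]
  · rw [not_exists] at hq
    rw [s_coeff_of_ne p F 0 q hq, s_coeff_of_ne p F 0 _ (ne_expo_of_mul hq), sub_zero,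
      HahnSeries.coeff_single_of_ne]
    rw [← mul_expo_zero p]
    exact fun h => hq 0 (mul_left_cancel₀ (NeZero.ne _) h)

theorem s_succ_pow_sub (m : ℕ) : s p F (m + 1) ^ p - s p F (m + 1) = s p F m := by
  ext r
  obtain ⟨q, rfl⟩ : ∃ q, r = p * q := ⟨r / p, (mul_div_cancel₀ _ (NeZero.ne _)).symm⟩
  rw [HahnSeries.coeff_sub, coeff_s_pow]
  by_cases hq : ∃ j, q = expo p j
  · obtain ⟨_ | j, rfl⟩ := hq
    · rw [mul_expo_zero, s_coeff_expo, s_coeff_neg_one, s_coeff_neg_one, Nat.choose_zero_succ,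
        Nat.cast_zero, sub_zero]
    · rw [mul_expo_succ, s_coeff_expo, s_coeff_expo, s_coeff_expo, Nat.choose_succ_succ,
        Nat.cast_add, add_sub_cancel_right]
  · rw [not_exists] at hq
    rw [s_coeff_of_ne p F _ q hq, s_coeff_of_ne p F _ _ (ne_expo_of_mul hq),
      s_coeff_of_ne p F _ _ (ne_expo_of_mul hq), sub_zero]

end Series

section Independence

/-- Passing from `j` to `j + 1` and subtracting lowers the index `m` by one, by Pascal's rule. -/
theorem eq_zero_of_sum_mul_choose_eq_zero {R : Type*} [CommRing R] {n J : ℕ} {b : Fin n → R}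
    (h : ∀ j ≥ J, ∑ m, b m * (j.choose m : R) = 0) : b = 0 := by
  induction n with
  | zero => exact Subsingleton.elim b 0
  | succ n ih =>
    have hsucc : Fin.tail b = 0 := by
      refine ih fun j hj => ?_
      have h₁ := h j hj
      have h₂ := h (j + 1) (by lia)
      rw [Fin.sum_univ_succ] at h₁ h₂
      simp only [Fin.val_succ, Nat.choose_succ_succ, Nat.cast_add, mul_add, Finset.sum_add_distrib,
        Fin.val_zero, Nat.choose_zero_right] at h₁ h₂
      rw [Fin.tail_def]
      linear_combination h₂ - h₁
    refine funext <| Fin.cases ?_ (congrFun hsucc)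
    have h₀ := h J le_rfl
    rwa [Fin.sum_univ_succ, Finset.sum_eq_zero fun m _ => by
        rw [show b m.succ = 0 from congrFun hsucc m, zero_mul], add_zero, Fin.val_zero,
      Nat.choose_zero_right, Nat.cast_one, mul_one] at h₀

variable {p : ℕ} [Fact p.Prime] {F : Type*} [Field F]

theorem coeff_expo_eq_zero_of_mem_laurentRoot {N : ℕ+} {x : Hahn F} (hx : x ∈ laurentRoot F N)
    {j : ℕ} (hj : N ≤ j) : x.coeff (expo p j) = 0 := by
  by_contra hne
  obtain ⟨k, hk⟩ := mem_laurentRoot.1 hx _ hne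
  replace hk : -1 / (p : ℚ) ^ (j + 1) = k / (N : ℕ) := hk
  have hp0 : (p : ℚ) ≠ 0 := NeZero.ne _
  have hN0 : ((N : ℕ) : ℚ) ≠ 0 := Nat.cast_ne_zero.2 N.ne_zero
  rw [div_eq_div_iff (pow_ne_zero _ hp0) hN0] at hk
  have hdvd : p ^ (j + 1) ∣ (N : ℕ) := by
    rw [← Int.natCast_dvd_natCast]
    refine ⟨-k, ?_⟩
    push_cast
    have : -1 * ((N : ℕ) : ℤ) = k * (p : ℤ) ^ (j + 1) := by exact_mod_cast hk
    linarith
  have hlt : j + 1 < p ^ (j + 1) := Nat.lt_pow_self (Fact.out : p.Prime).one_lt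
  have := Nat.le_of_dvd N.pos hdvd
  lia

theorem eq_zero_of_sum_C_mul_s_mem_Puiseux {n : ℕ} {b : Fin n → F}
    (h : ∑ m, HahnSeries.C (b m) * s p F m ∈ Puiseux F) : b = 0 := by
  obtain ⟨N, hN⟩ := h
  refine eq_zero_of_sum_mul_choose_eq_zero (J := N) fun j hj => ?_
  rw [← coeff_expo_eq_zero_of_mem_laurentRoot (p := p) hN hj, HahnSeries.coeff_sum]
  simp only [HahnSeries.C_mul_eq_smul, HahnSeries.coeff_smul, s_coeff_expo, smul_eq_mul]

end Independence

section ArtinSchreier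

open Polynomial

variable (p : ℕ) [Fact p.Prime]

/-- The Artin-Schreier operator `x ↦ x ^ p - x` of a commutative ring of characteristic `p`, as an
element of the endomorphism ring of the additive group: its powers are its iterates. -/
def artinSchreier (R : Type*) [CommRing R] [CharP R p] : AddMonoid.End R :=
  (frobenius R p : R →+ R) - AddMonoidHom.id R

section CommRing

variable {R S : Type*} [CommRing R] [CommRing S] [CharP R p] [CharP S p]

theorem artinSchreier_apply (x : R) : artinSchreier p R x = x ^ p - x := rfl

theorem artinSchreier_pow_succ_apply (n : ℕ) (x : R) :
    (artinSchreier p R ^ (n + 1)) x =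
      (artinSchreier p R ^ n) x ^ p - (artinSchreier p R ^ n) x := by
  rw [pow_succ', AddMonoid.End.coe_mul, Function.comp_apply, artinSchreier_apply]

theorem map_artinSchreier_pow (f : R →+* S) (n : ℕ) (x : R) :
    f ((artinSchreier p R ^ n) x) = (artinSchreier p S ^ n) (f x) := by
  induction n with
  | zero => rfl
  | succ n ih =>
    rw [artinSchreier_pow_succ_apply, artinSchreier_pow_succ_apply, map_sub, map_pow, ih]

theorem aeval_artinSchreier_pow_X [Algebra R S] (n : ℕ) (y : S) :
    aeval y ((artinSchreier p R[X] ^ n) X) = (artinSchreier p S ^ n) y := by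
  have h := map_artinSchreier_pow p (aeval (R := R) y).toRingHom n X
  rwa [AlgHom.toRingHom_eq_coe, RingHom.coe_coe, aeval_X] at h

theorem map_artinSchreier_pow_X (f : R →+* S) (n : ℕ) :
    ((artinSchreier p R[X] ^ n) X).map f = (artinSchreier p S[X] ^ n) X := by
  rw [← map_X f]
  exact map_artinSchreier_pow p (mapRingHom f) n X

theorem artinSchreier_pow_X_comp (n : ℕ) (x : R) :
    ((artinSchreier p R[X] ^ n) X).comp (X - C x) =
      (artinSchreier p R[X] ^ n) X - C ((artinSchreier p R ^ n) x) :=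
  calc ((artinSchreier p R[X] ^ n) X).comp (X - C x)
      = (artinSchreier p R[X] ^ n) (X - C x) := by
        rw [← coe_compRingHom_apply, map_artinSchreier_pow, coe_compRingHom_apply, X_comp]
    _ = _ := by rw [map_sub, ← map_artinSchreier_pow p C]

theorem derivative_artinSchreier_pow_X (n : ℕ) :
    derivative ((artinSchreier p R[X] ^ n) X) = (-1) ^ n := by
  induction n with
  | zero => exact derivative_X
  | succ n ih =>
    rw [artinSchreier_pow_succ_apply, derivative_sub, derivative_pow, ih, CharP.cast_eq_zero,
      C_0, zero_mul, zero_mul, zero_sub, pow_succ, mul_neg_one]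

theorem isMonicOfDegree_artinSchreier_pow_X [Nontrivial R] (n : ℕ) :
    IsMonicOfDegree ((artinSchreier p R[X] ^ n) X) (p ^ n) := by
  induction n with
  | zero => exact isMonicOfDegree_X R
  | succ n ih =>
    rw [artinSchreier_pow_succ_apply, pow_succ]
    exact (ih.pow p).sub (ih.natDegree_eq.trans_lt <|
      lt_mul_of_one_lt_right (pow_pos (NeZero.pos p) n) (Fact.out : p.Prime).one_lt)

theorem isMonicOfDegree_artinSchreier_pow_X_sub_C [Nontrivial R] (n : ℕ) (a : R) :
    IsMonicOfDegree ((artinSchreier p R[X] ^ n) X - C a) (p ^ n) :=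
  (isMonicOfDegree_artinSchreier_pow_X p n).sub <| by
    rw [natDegree_C]
    exact pow_pos (NeZero.pos p) n

end CommRing

theorem splits_artinSchreier_pow_X_sub_C {F L : Type*} [Field F] [IsAlgClosed F] [CharP F p]
    [Field L] [CharP L p] [Algebra F L] (n : ℕ) (x : L) :
    ((artinSchreier p L[X] ^ n) X - C ((artinSchreier p L ^ n) x)).Splits := by
  rw [← artinSchreier_pow_X_comp, ← map_artinSchreier_pow_X p (algebraMap F L)]
  exact ((IsAlgClosed.splits _).map _).comp_X_sub_C x

end ArtinSchreier

section Field

open Polynomial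

/-- The remainder of `g` modulo the minimal polynomial takes one value at all its roots. -/
theorem aeval_mem_range_algebraMap {K L : Type*} [Field K] [Field L] [Algebra K L] {x : L}
    (hsep : IsSeparable K x) (hsplits : ((minpoly K x).map (algebraMap K L)).Splits) {g : K[X]}
    (hg : ∀ y, IsConjRoot K x y → aeval y g = aeval x g) :
    aeval x g ∈ (algebraMap K L).range := by
  set f := minpoly K x
  have hintegral : IsIntegral K x := hsep.isIntegral
  have hr (y : L) (hy : IsConjRoot K x y) : aeval y (g %ₘ f) = aeval x g := by
    rw [aeval_modByMonic_eq_self_of_root hy.aeval_eq_zero, hg y hy]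
  have hconst : (g %ₘ f).map (algebraMap K L) = C (aeval x g) := by
    refine eq_of_degree_sub_lt_of_eval_finset_eq (f.rootSet L).toFinset ?_ fun y hy => ?_
    · rw [Set.toFinset_card, card_rootSet_eq_natDegree hsep hsplits,
        ← degree_eq_natDegree (minpoly.ne_zero hintegral)]
      refine (degree_sub_le _ _).trans_lt (max_lt ?_ ?_)
      · exact degree_map_le.trans_lt (degree_modByMonic_lt g (minpoly.monic hintegral))
      · exact degree_C_le.trans_lt (minpoly.degree_pos hintegral)
    · rw [eval_map_algebraMap, eval_C, hr]
      exact (isConjRoot_iff_mem_minpoly_rootSet hintegral).2 (Set.mem_toFinset.1 hy)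
  refine ⟨(g %ₘ f).coeff 0, ?_⟩
  rw [← coeff_map, hconst, coeff_C_zero]

section Minpoly

variable {p : ℕ} [Fact p.Prime] {K L : Type*} [Field K] [Field L] [CharP K p] [CharP L p]
  [Algebra K L] {x : L} {a : K} {n : ℕ}

theorem minpoly_dvd_artinSchreier (hx : (artinSchreier p L ^ n) x = algebraMap K L a) :
    minpoly K x ∣ (artinSchreier p K[X] ^ n) X - C a :=
  minpoly.dvd K x <| by rw [map_sub, aeval_artinSchreier_pow_X, hx, aeval_C, sub_self]

theorem isSeparable_of_artinSchreier (hx : (artinSchreier p L ^ n) x = algebraMap K L a) :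
    IsSeparable K x := by
  refine Separable.of_dvd ?_ (minpoly_dvd_artinSchreier hx)
  rw [separable_def, derivative_sub, derivative_C, sub_zero, derivative_artinSchreier_pow_X]
  exact isCoprime_one_right.neg_right.pow_right

theorem natDegree_minpoly_le_of_artinSchreier
    (hx : (artinSchreier p L ^ n) x = algebraMap K L a) : (minpoly K x).natDegree ≤ p ^ n := by
  have hdeg := isMonicOfDegree_artinSchreier_pow_X_sub_C p n a
  exact hdeg.natDegree_eq ▸ natDegree_le_of_dvd (minpoly_dvd_artinSchreier hx) hdeg.ne_zero

theorem splits_minpoly_of_artinSchreier (F : Type*) [Field F] [IsAlgClosed F] [CharP F p]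
    [Algebra F L] (hx : (artinSchreier p L ^ n) x = algebraMap K L a) :
    ((minpoly K x).map (algebraMap K L)).Splits := by
  refine (splits_artinSchreier_pow_X_sub_C (F := F) p n x).of_dvd
    (isMonicOfDegree_artinSchreier_pow_X_sub_C p n _).ne_zero ?_
  rw [hx, ← map_artinSchreier_pow_X p (algebraMap K L), ← map_C, ← Polynomial.map_sub]
  exact Polynomial.map_dvd _ (minpoly_dvd_artinSchreier hx)

theorem exists_add_algebraMap_of_isConjRoot (F : Type*) [Field F] [IsAlgClosed F] [CharP F p]
    [Algebra F L] (hx : (artinSchreier p L ^ n) x = algebraMap K L a) {y : L}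
    (hy : IsConjRoot K x y) : ∃ c : F, y = x + algebraMap F L c := by
  have hroot : aeval y ((artinSchreier p K[X] ^ n) X - C a) = 0 :=
    aeval_eq_zero_of_dvd_aeval_eq_zero (minpoly_dvd_artinSchreier hx) hy.aeval_eq_zero
  rw [map_sub, aeval_artinSchreier_pow_X, aeval_C, ← hx, ← map_sub] at hroot
  obtain ⟨c, hc⟩ := (IsAlgClosed.splits ((artinSchreier p F[X] ^ n) X)).mem_range_of_isRoot
    (isMonicOfDegree_artinSchreier_pow_X p n).ne_zero (i := algebraMap F L) (x := y - x) <| by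
      rw [IsRoot, eval_map_algebraMap, aeval_artinSchreier_pow_X, hroot]
  exact ⟨c, by rw [hc, add_sub_cancel]⟩

end Minpoly

section Translations

variable (K F : Type*) {L : Type*} [Field K] [Field L] [Field F] [Algebra K L] [Algebra F K]
  [Algebra F L] [IsScalarTower F K L]

/-- The translations by `F` which move `x` to a conjugate over `K`. -/
def conjTranslations (x : L) : AddSubgroup F where
  carrier := {c | IsConjRoot K x (x + algebraMap F L c)}
  zero_mem' := by
    rw [Set.mem_ofPred, map_zero, add_zero]
  add_mem' {c d} hc hd := by
    rw [Set.mem_ofPred] at hc hd ⊢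
    have h := hd.add_algebraMap (algebraMap F K c)
    rw [← IsScalarTower.algebraMap_apply] at h
    rw [map_add, add_comm (algebraMap F L c), ← add_assoc]
    exact hc.trans h
  neg_mem' {c} hc := by
    rw [Set.mem_ofPred] at hc ⊢
    have h := hc.add_algebraMap (algebraMap F K (-c))
    rw [← IsScalarTower.algebraMap_apply, map_neg, add_neg_cancel_right] at h
    rw [map_neg]
    exact h.symm

variable {K F} {x : L}

theorem card_conjTranslations_le (hintegral : IsIntegral K x) :
    Finite (conjTranslations K F x) ∧
      Nat.card (conjTranslations K F x) ≤ (minpoly K x).natDegree := by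
  have hinj : Set.InjOn (fun c : F => x + algebraMap F L c) (conjTranslations K F x) :=
    ((add_right_injective x).comp (algebraMap F L).injective).injOn
  have hmaps : Set.MapsTo (fun c : F => x + algebraMap F L c) (conjTranslations K F x)
      ((minpoly K x).rootSet L) := fun c hc =>
    (isConjRoot_iff_mem_minpoly_rootSet hintegral).1 hc
  have hfin := (minpoly K x).rootSet_finite L
  exact ⟨hfin.of_injOn hmaps hinj,
    (Set.ncard_le_ncard_of_injOn _ hmaps hinj hfin).trans (ncard_rootSet_le _ L)⟩

end Translations

/-- If `V` has dimension `d` over `𝔽_p`, then so does `Hom(V, F)` over `F`. -/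
theorem pow_card_le_card_addSubgroup {p : ℕ} [Fact p.Prime] {F : Type*} [Field F] [CharP F p]
    {ι : Type*} [Fintype ι] (φ : ι → F →+ F) (V : AddSubgroup F) [Finite V]
    (h : ∀ g : ι → F, (∀ c ∈ V, ∑ i, g i * φ i c = 0) → g = 0) :
    p ^ Fintype.card ι ≤ Nat.card V := by
  let := ZMod.algebra F p
  let W : Submodule (ZMod p) F := AddSubgroup.toZModSubmodule p V
  have : Finite W := ‹Finite V›
  let ψ (i : ι) : W →ₗ[ZMod p] F := ((φ i).toZModLinearMap p).comp W.subtype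
  have hψ : LinearIndependent F ψ := Fintype.linearIndependent_iff.2 fun g hg =>
    congrFun <| h g fun c hc => by
      have := LinearMap.congr_fun hg ⟨c, hc⟩
      rwa [LinearMap.sum_apply] at this
  calc p ^ Fintype.card ι ≤ p ^ Module.finrank (ZMod p) W := by
        refine Nat.pow_le_pow_right (NeZero.pos p) ?_
        rw [← Module.finrank_linearMap_self (ZMod p) F W]
        exact hψ.fintype_card_le_finrank
    _ = Nat.card W := by rw [Module.natCard_eq_pow_finrank (K := ZMod p) (V := W), Nat.card_zmod]

variable {p : ℕ} [Fact p.Prime] {F K L : Type*} [Field F] [IsAlgClosed F] [CharP F p] [Field K]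
  [CharP K p] [Field L] [CharP L p] [Algebra K L] [Algebra F K] [Algebra F L] [IsScalarTower F K L]
  {x : L} {a : K} {n : ℕ}

theorem sum_mul_artinSchreier_mem_range (hx : (artinSchreier p L ^ n) x = algebraMap K L a)
    {g : Fin n → F}
    (hg : ∀ c ∈ conjTranslations K F x, ∑ l, g l * (artinSchreier p F ^ (l : ℕ)) c = 0) :
    ∑ l, algebraMap F L (g l) * (artinSchreier p L ^ (l : ℕ)) x ∈ (algebraMap K L).range := by
  have haeval (y : L) : aeval y (∑ l, C (algebraMap F K (g l)) * (artinSchreier p K[X] ^ (l : ℕ)) X)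
      = ∑ l, algebraMap F L (g l) * (artinSchreier p L ^ (l : ℕ)) y := by
    simp only [map_sum, map_mul, aeval_C, aeval_artinSchreier_pow_X,
      ← IsScalarTower.algebraMap_apply]
  rw [← haeval]
  refine aeval_mem_range_algebraMap (isSeparable_of_artinSchreier hx)
    (splits_minpoly_of_artinSchreier F hx) fun y hy => ?_
  obtain ⟨c, rfl⟩ := exists_add_algebraMap_of_isConjRoot F hx hy
  rw [haeval, haeval]
  simp only [map_add, mul_add, Finset.sum_add_distrib, ← map_artinSchreier_pow, ← map_mul,
    ← map_sum]
  rw [hg c hy, map_zero, add_zero]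

theorem natDegree_minpoly_of_artinSchreier (hx : (artinSchreier p L ^ n) x = algebraMap K L a)
    (hind : ∀ g : Fin n → F,
      ∑ l, algebraMap F L (g l) * (artinSchreier p L ^ (l : ℕ)) x ∈ (algebraMap K L).range →
        g = 0) :
    (minpoly K x).natDegree = p ^ n := by
  refine (natDegree_minpoly_le_of_artinSchreier hx).antisymm ?_
  obtain ⟨_, hcard⟩ :=
    card_conjTranslations_le (F := F) (isSeparable_of_artinSchreier hx).isIntegral
  refine le_trans ?_ hcard
  simpa only [Fintype.card_fin] using pow_card_le_card_addSubgroup (p := p)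
    (fun l : Fin n => artinSchreier p F ^ (l : ℕ)) (conjTranslations K F x)
    fun g hg => hind g (sum_mul_artinSchreier_mem_range hx hg)

end Field

section Degree

open Finset IntermediateField

variable (p : ℕ) [Fact p.Prime] (F : Type*) [Field F]

/-- The field `K(s_0, …, s_{n-1})`, which lies in `K(u)` for every `u` in the ball
`B_{n-1}(s_{n,n})`. -/
def tower (n : ℕ) : IntermediateField (Puiseux F) (Hahn F) :=
  adjoin (Puiseux F) (s p F '' Set.Iio n)

variable {F} in
theorem s_mem_tower {m n : ℕ} (h : m < n) : s p F m ∈ tower p F n :=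
  subset_adjoin _ _ ⟨m, h, rfl⟩

theorem sDiag_mem_tower (n : ℕ) : sDiag p F n ∈ tower p F n :=
  sum_mem fun m hm => mul_mem (pow_mem (t_mem _) m) (s_mem_tower p (mem_range.1 hm))

theorem le_v_sDiag_sub_sDiag {i n : ℕ} (hin : i < n) :
    ((i : ℚ) : WithTop ℚ) ≤ v (sDiag p F n - sDiag p F (i + 1)) := by
  rw [sDiag, sDiag, ← sum_Ico_eq_sub _ hin]
  refine (HahnSeries.addVal ℚ F).map_le_sum fun m hm => ?_
  calc ((i : ℚ) : WithTop ℚ) ≤ ((m : ℚ) + -1 : ℚ) := by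
        have : ((i + 1 : ℕ) : ℚ) ≤ m := Nat.cast_le.2 (mem_Ico.1 hm).1
        push_cast at this
        exact WithTop.coe_le_coe.2 (by linarith)
    _ ≤ v (t F ^ m) + v (s p F m) := by
        rw [WithTop.coe_add, v_t_pow]
        exact add_le_add_right (neg_one_le_v_s p F m) _
    _ = v (t F ^ m * s p F m) := (v_mul _ _).symm

variable {p F} in
theorem le_v_sub_sDiag {i n : ℕ} (hin : i < n) {u : Hahn F}
    (hu : u ∈ ball ((n : ℚ) - 1) (sDiag p F n)) :
    ((i : ℚ) : WithTop ℚ) ≤ v (u - sDiag p F (i + 1)) := by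
  have hle : (i : ℚ) ≤ n - 1 := by
    rw [le_sub_iff_add_le]
    exact_mod_cast hin
  rw [← sub_add_sub_cancel u (sDiag p F n)]
  exact (le_min ((WithTop.coe_le_coe.2 hle).trans hu.2) (le_v_sDiag_sub_sDiag p F hin)).trans
    HahnSeries.min_orderTop_le_orderTop_add

variable [CharP F p]

instance charP_Puiseux : CharP (Puiseux F) p :=
  (algebraMap (Puiseux F) (Hahn F)).charP (algebraMap (Puiseux F) (Hahn F)).injective p

theorem artinSchreier_pow_s (l m : ℕ) :
    (artinSchreier p (Hahn F) ^ l) (s p F (l + m)) = s p F m := by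
  induction l generalizing m with
  | zero => rw [zero_add, pow_zero, AddMonoid.End.coe_one, id]
  | succ l ih => rw [artinSchreier_pow_succ_apply, add_assoc, ih, add_comm 1, s_succ_pow_sub]

theorem artinSchreier_pow_succ_s (m : ℕ) :
    (artinSchreier p (Hahn F) ^ (m + 1)) (s p F m) =
      algebraMap (Puiseux F) (Hahn F) ⟨t F, t_mem_Puiseux⟩⁻¹ := by
  have h := artinSchreier_pow_s p F m 0
  rw [add_zero] at h
  rw [artinSchreier_pow_succ_apply, h, s_zero_pow_sub, map_inv₀]
  rfl

theorem isIntegral_s (m : ℕ) : IsIntegral (Puiseux F) (s p F m) :=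
  (isSeparable_of_artinSchreier (artinSchreier_pow_succ_s p F m)).isIntegral

theorem deg_s [IsAlgClosed F] (m : ℕ) : deg (s p F m) = p ^ (m + 1) := by
  let : Algebra F (Puiseux F) :=
    ((HahnSeries.C : F →+* Hahn F).codRestrict (Puiseux F) C_mem_Puiseux).toAlgebra
  -- Instance search would pick the algebra structure that factors through power series.
  let : Algebra F (Hahn F) := HahnSeries.instAlgebra
  have := IsScalarTower.of_algebraMap_eq (R := F) (S := Puiseux F) (A := Hahn F) fun _ => rfl
  refine natDegree_minpoly_of_artinSchreier (F := F) (artinSchreier_pow_succ_s p F m) fun g hg => ?_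
  have hsum : ∑ l, algebraMap F (Hahn F) (g l) * (artinSchreier p (Hahn F) ^ (l : ℕ)) (s p F m) =
      ∑ l : Fin (m + 1), HahnSeries.C (g l.rev) * s p F l := by
    rw [← Equiv.sum_comp Fin.revPerm]
    refine sum_congr rfl fun l _ => ?_
    have hl : (l.rev : ℕ) + l = m := by
      rw [Fin.val_rev]
      lia
    have hs := artinSchreier_pow_s p F l.rev l
    rw [hl] at hs
    rw [Fin.revPerm_apply, hs]
    rfl
  obtain ⟨b, hb⟩ := hg
  have hrev := eq_zero_of_sum_C_mul_s_mem_Puiseux (p := p) (b := fun l => g l.rev)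
    (hsum ▸ hb ▸ b.2)
  exact funext fun l => by simpa only [Fin.rev_rev, Pi.zero_apply] using congrFun hrev l.rev

theorem monotone_adjoin_s : Monotone fun m => (Puiseux F)⟮s p F m⟯ := by
  refine monotone_nat_of_le_succ fun m => adjoin_simple_le_iff.2 ?_
  have h := mem_adjoin_simple_self (Puiseux F) (s p F (m + 1))
  rw [← s_succ_pow_sub p F m]
  exact sub_mem (pow_mem h p) h

theorem tower_succ (n : ℕ) : tower p F (n + 1) = (Puiseux F)⟮s p F n⟯ := by
  refine le_antisymm (adjoin_le_iff.2 ?_) (adjoin.mono _ _ _ ?_)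
  · rintro _ ⟨m, hm, rfl⟩
    exact monotone_adjoin_s p F (Nat.lt_succ_iff.1 hm) (mem_adjoin_simple_self _ _)
  · exact Set.singleton_subset_iff.2 ⟨n, n.lt_succ_self, rfl⟩

theorem finrank_tower [IsAlgClosed F] (n : ℕ) :
    Module.finrank (Puiseux F) (tower p F n) = p ^ n := by
  cases n with
  | zero =>
    have hempty : Set.Iio 0 = (∅ : Set ℕ) := Set.Iio_bot
    rw [tower, hempty, Set.image_empty, adjoin_empty, IntermediateField.finrank_bot, pow_zero]
  | succ n => rw [tower_succ, adjoin.finrank (isIntegral_s p F n), ← deg_s p F n, deg]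

theorem tower_le_Kbar (n : ℕ) : tower p F n ≤ Kbar F := by
  rw [tower, adjoin_le_iff]
  rintro _ ⟨m, -, rfl⟩
  exact mem_algebraicClosure_iff.2 (isIntegral_s p F m).isAlgebraic

variable {p F} in
theorem tower_le_adjoin_of_mem_ball {n : ℕ} {u : Hahn F}
    (hu : u ∈ ball ((n : ℚ) - 1) (sDiag p F n)) : tower p F n ≤ (Puiseux F)⟮u⟯ := by
  suffices hs : ∀ i < n, s p F i ∈ (Puiseux F)⟮u⟯ from
    adjoin_le_iff.2 (Set.image_subset_iff.2 hs)
  intro i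
  induction i using Nat.strong_induction_on with
  | _ i ih =>
  intro hin
  have hdiag : sDiag p F i ∈ (Puiseux F)⟮u⟯ := sum_mem fun m hm =>
    mul_mem (pow_mem (t_mem _) m) (ih m (mem_range.1 hm) ((mem_range.1 hm).trans hin))
  have hroot : s p F i ^ p - s p F i ∈ (Puiseux F)⟮u⟯ := by
    cases i with
    | zero => exact s_zero_pow_sub p F ▸ inv_mem (t_mem _)
    | succ i => exact s_succ_pow_sub p F i ▸ ih i i.lt_succ_self (i.lt_succ_self.trans hin)
  set y := (t F ^ i)⁻¹ * (u - sDiag p F i)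
  have hy : y ∈ (Puiseux F)⟮u⟯ :=
    mul_mem (inv_mem (pow_mem (t_mem _) i)) (sub_mem (mem_adjoin_simple_self _ u) hdiag)
  have hty : t F ^ i * (y - s p F i) = u - sDiag p F (i + 1) := by
    rw [mul_sub, mul_inv_cancel_left₀ (pow_ne_zero i t_ne_zero), sDiag, sDiag, sum_range_succ,
      sub_sub]
  have hv : 0 ≤ v (y - s p F i) := by
    have h := le_v_sub_sDiag hin hu
    rw [← hty, v_mul, v_t_pow] at h
    exact WithTop.le_of_add_le_add_left WithTop.coe_ne_top ((add_zero _).trans_le h)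
  exact mem_of_zero_le_v_sub (p := p) (adjoin_simple_le_iff.2 hu.1) hroot hy hv

variable [IsAlgClosed F]

variable {p F} in
theorem pow_le_deg_of_mem_ball {n : ℕ} {u : Hahn F}
    (hu : u ∈ ball ((n : ℚ) - 1) (sDiag p F n)) : p ^ n ≤ deg u := by
  have hintegral : IsIntegral (Puiseux F) u := (mem_algebraicClosure_iff.1 hu.1).isIntegral
  have : FiniteDimensional (Puiseux F) (Puiseux F)⟮u⟯ := adjoin.finiteDimensional hintegral
  rw [deg, ← adjoin.finrank hintegral, ← finrank_tower p F n]
  exact finrank_le_of_le_right (tower_le_adjoin_of_mem_ball hu)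

theorem deg_sDiag_le (n : ℕ) : deg (sDiag p F n) ≤ p ^ n := by
  have : FiniteDimensional (Puiseux F) (tower p F n) := .of_finrank_pos <| by
    rw [finrank_tower]
    exact pow_pos (Fact.out : p.Prime).pos n
  have hmem := sDiag_mem_tower p F n
  rw [deg, ← adjoin.finrank (mem_algebraicClosure_iff.1 (tower_le_Kbar p F n hmem)).isIntegral,
    ← finrank_tower p F n]
  exact finrank_le_of_le_right (adjoin_simple_le_iff.2 hmem)

end Degree

end HahnTower

end

theorem mainTheorem4_general (p : ℕ) [Fact p.Prime] (F : Type*) [Field F] [IsAlgClosed F]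
    [CharP F p] (n : ℕ) :
    HahnTower.sDiag p F n ∈ HahnTower.Kbar F ∧
    (∀ u ∈ HahnTower.ball ((n : ℚ) - 1) (HahnTower.sDiag p F n), p ^ n ≤ HahnTower.deg u) ∧
    HahnTower.degSet (HahnTower.ball ((n : ℚ) - 1) (HahnTower.sDiag p F n)) = p ^ n := by
  have halg := HahnTower.tower_le_Kbar p F n (HahnTower.sDiag_mem_tower p F n)
  have hdeg u (hu : u ∈ HahnTower.ball ((n : ℚ) - 1) (HahnTower.sDiag p F n)) :
      p ^ n ≤ HahnTower.deg u := HahnTower.pow_le_deg_of_mem_ball hu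
  have hball : HahnTower.sDiag p F n ∈ HahnTower.ball ((n : ℚ) - 1) (HahnTower.sDiag p F n) := by
    refine ⟨halg, ?_⟩
    rw [sub_self, HahnTower.v, HahnSeries.orderTop_zero]
    exact le_top
  have hleast : IsLeast (HahnTower.deg '' HahnTower.ball ((n : ℚ) - 1) (HahnTower.sDiag p F n))
      (p ^ n) :=
    ⟨⟨_, hball, (HahnTower.deg_sDiag_le p F n).antisymm (hdeg _ hball)⟩,
      Set.forall_mem_image.2 hdeg⟩
  exact ⟨halg, hdeg, hleast.csInf_eq⟩

theorem mainTheorem4 (p : ℕ) [Fact p.Prime] (F : Type*) [Field F] [Algebra (ZMod p) F]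
    [IsAlgClosure (ZMod p) F] (n : ℕ) (hn : 1 ≤ n) :
    HahnTower.sDiag p F n ∈ HahnTower.Kbar F ∧
    (∀ u ∈ HahnTower.ball ((n : ℚ) - 1) (HahnTower.sDiag p F n), p ^ n ≤ HahnTower.deg u) ∧
    HahnTower.degSet (HahnTower.ball ((n : ℚ) - 1) (HahnTower.sDiag p F n)) = p ^ n := by
  have : IsAlgClosed F := IsAlgClosure.isAlgClosed (ZMod p)
  have : CharP F p := charP_of_injective_algebraMap (algebraMap (ZMod p) F).injective p
  exact mainTheorem4_general p F n
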